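/- Let $F=\mathbf Z/2$, let $V$ be an $F$-vector space with a symplectic (i.e. alternating, possibly degenerate) bilinear form $\langle\,,\rangle$ and a finite basis $(e_s)_{s\in S}$, and let $\mathfrak E$ be the set of unordered pairs $\{s,s'\}$ with $s\ne s'$ and $\langle e_s,e_{s'}\rangle=1$. Assume that the graph $(S,\mathfrak E)$ is a cycle with $N=|S|$ vertices, where $N\ge 3$ is odd (affine type $A_{N-1}$). For $I\subset S$ put $e_I=\sum_{s\in I}e_s$; the vector $e_S$ lies in the radical of the form. Let $\bar V=V/Fe_S$, with the induced form, let $\bar e_s$ be the image of $e_s$ and $\bar e_I=\sum_{s\in I}\bar e_s$. For $I\subset S$ let $\underline I$ be the full subgraph on $I$. Let $\mathcal I^1$ be the set of $I\subset S$ with $|I|$ odd such that $\underline I$ is a path. For $I,I'\subset S$ write $I\prec I'$ if $I\subsetneq I'$ and $\underline{I'-I}$ is disconnected, and $I\spadesuit I'$ if $I\cap I'=\emptyset$ and $\underline{I\cup I'}$ is disconnected. For $I\in\mathcal I^1$ let $I^{ev}$ be the set of $s\in I$ such that $I-\{s\}=I'\sqcup I''$ for some $I',I''\in\mathcal I^1$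 with $I'\spadesuit I''$, and let $I^{odd}=I-I^{ev}$. Let $\varphi(\bar V)$ be the set of all finite subsets $B\subset\mathcal I^1$ such that $(P_0)$ for all $I,I'\in B$: $I=I'$, or $I\spadesuit I'$, or $I\prec I'$, or $I'\prec I$; $(P_1)$ for every $I\in B$ there are $k\ge0$ and pairwise disjoint $I_1,\dots,I_k\in B$ with $I_j\prec I$ for all $j$ and $I^{ev}\subset I_1\sqcup\dots\sqcup I_k$. For $B\in\varphi(\bar V)$ let $L_B\subset\bar V$ be the span of $\{\bar e_I: I\in B\}$ and $\mathrm{supp}(B)=\bigcup_{I\in B}I$. For an edge $\mathbf e\in\mathfrak E$, regarded as a two-element subset of $S$, put $[\mathbf e]=\bar e_{(S-\mathbf e)^{odd}}\in\bar V$. Then for every $B\in\varphi(\bar V)$ one has $|B|\le(|S|-1)/2$, and for every $\mathbf e\in\mathfrak E$: $[\mathbf e]\in L_B$ if and only if $\mathrm{supp}(B)\cap\mathbf e=\emptyset$ and $|B|=(|S|-1)/2$. -/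

import Mathlib

/-!
`ω` is a bilinear form on a vector space over the field with two elements `ZMod 2`, and
`e : S → V` is a family of vectors indexed by a finite set `S`.
-/

noncomputable section

/-- The graph on `S` whose edges are the unordered pairs `s ≠ t` with `⟨e_s, e_t⟩ = 1`
(`ω` is alternating, hence symmetric, wherever this is used, so the order of `s`, `t` is
immaterial). -/
def edgeGraph {S V : Type*} [AddCommGroup V] [Module (ZMod 2) V]
    (ω : LinearMap.BilinForm (ZMod 2) V) (e : S → V) : SimpleGraph S :=
  SimpleGraph.fromRel fun s t => ω (e s) (e t) = 1

/-- The vector `e_I = ∑_{s ∈ I} e_s`. -/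
def vecSum {S V : Type*} [AddCommGroup V] (e : S → V) (I : Finset S) : V :=
  ∑ s ∈ I, e s

/-- The full subgraph of `G` on the vertex set `I` is disconnected: it has two vertices that no
path inside `I` joins. -/
def IsDisconnectedOn {S : Type*} (G : SimpleGraph S) (I : Finset S) : Prop :=
  ¬ (G.induce (I : Set S)).Preconnected

/-- `I ∈ ℐ`: the full subgraph of `G` on `I` is of type `A_m` (a path with `m` vertices) for
some `m ≥ 1`. -/
def IsInterval {S : Type*} (G : SimpleGraph S) (I : Finset S) : Prop :=
  ∃ m : ℕ, 1 ≤ m ∧ Nonempty (G.induce (I : Set S) ≃g SimpleGraph.pathGraph m)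

/-- `I ∈ ℐ¹`: `I ∈ ℐ` and `|I|` is odd. -/
def IsOddInterval {S : Type*} (G : SimpleGraph S) (I : Finset S) : Prop :=
  IsInterval G I ∧ Odd I.card

/-- `I ≺ I'`: `I ⊊ I'` and the full subgraph on `I' - I` is disconnected. -/
def Prec {S : Type*} [DecidableEq S] (G : SimpleGraph S) (I I' : Finset S) : Prop :=
  I ⊂ I' ∧ IsDisconnectedOn G (I' \ I)

/-- `I ♠ I'`: `I ∩ I' = ∅` and the full subgraph on `I ∪ I'` is disconnected. -/
def Spade {S : Type*} [DecidableEq S] (G : SimpleGraph S) (I I' : Finset S) : Prop :=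
  Disjoint I I' ∧ IsDisconnectedOn G (I ∪ I')

open Classical in
/-- `I^ev`: the set of `s ∈ I` such that `I - {s}` is the union of some `I', I'' ∈ ℐ¹` with
`I' ♠ I''` (in particular `I'` and `I''` are disjoint). -/
def evPart {S : Type*} [DecidableEq S] (G : SimpleGraph S) (I : Finset S) : Finset S :=
  {s ∈ I | ∃ I' I'' : Finset S, IsOddInterval G I' ∧ IsOddInterval G I'' ∧
    I \ {s} = I' ∪ I'' ∧ Spade G I' I''}

/-- `I^odd = I - I^ev`. -/
def oddPart {S : Type*} [DecidableEq S] (G : SimpleGraph S) (I : Finset S) : Finset S :=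
  I \ evPart G I

/-- `supp(B) = ⋃_{I ∈ B} I`. -/
def supp {S : Type*} [DecidableEq S] (B : Finset (Finset S)) : Finset S :=
  B.biUnion id

/-- `L_B`: the subspace spanned by the `e_I`, `I ∈ B`. -/
def spanL {S V : Type*} [AddCommGroup V] [Module (ZMod 2) V]
    (e : S → V) (B : Finset (Finset S)) : Submodule (ZMod 2) V :=
  Submodule.span (ZMod 2) (vecSum e '' (B : Set (Finset S)))

/-- Condition `(P₀)`. -/
def CondP0 {S : Type*} [DecidableEq S] (G : SimpleGraph S) (B : Finset (Finset S)) : Prop :=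
  ∀ I ∈ B, ∀ I' ∈ B, I = I' ∨ Spade G I I' ∨ Prec G I I' ∨ Prec G I' I

/-- Condition `(P₁)`: for every `I ∈ B` there are pairwise disjoint `I₁, …, I_k ∈ B` (here, the
elements of `C`), all `≺ I`, whose union contains `I^ev`. -/
def CondP1 {S : Type*} [DecidableEq S] (G : SimpleGraph S) (B : Finset (Finset S)) : Prop :=
  ∀ I ∈ B, ∃ C ⊆ B, (C : Set (Finset S)).PairwiseDisjoint id ∧
    evPart G I ⊆ supp C ∧ ∀ J ∈ C, Prec G J I

/-- `φ(V)`: the finite subsets `B` of `ℐ¹` satisfying `(P₀)` and `(P₁)`. -/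
def phi {S V : Type*} [DecidableEq S] [AddCommGroup V] [Module (ZMod 2) V]
    (ω : LinearMap.BilinForm (ZMod 2) V) (e : S → V) : Set (Finset (Finset S)) :=
  {B | (∀ I ∈ B, IsOddInterval (edgeGraph ω e) I) ∧
    CondP0 (edgeGraph ω e) B ∧ CondP1 (edgeGraph ω e) B}

/-- The affine cyclic setting: `ω` is symplectic (alternating, possibly degenerate), and the graph
of the basis `e` is of affine type `A_{N-1}`, a cycle with `N` vertices, with `N ≥ 3` odd. -/
structure IsAffineCase {S V : Type*} [Fintype S] [AddCommGroup V] [Module (ZMod 2) V]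
    (ω : LinearMap.BilinForm (ZMod 2) V) (e : Module.Basis S (ZMod 2) V) : Prop where
  isAlt : ω.IsAlt
  three_le : 3 ≤ Fintype.card S
  odd_card : Odd (Fintype.card S)
  cycle : Nonempty (edgeGraph ω e ≃g SimpleGraph.cycleGraph (Fintype.card S))

/-- The vector `e_S` is orthogonal to all of `V`. -/
theorem IsAffineCase.total_mem_radical {S V : Type*} [Fintype S] [AddCommGroup V]
    [Module (ZMod 2) V] {ω : LinearMap.BilinForm (ZMod 2) V}
    {e : Module.Basis S (ZMod 2) V} (h : IsAffineCase ω e) :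
    ω (vecSum e Finset.univ) = 0 := by
  classical
  refine e.ext fun t => ?_
  have hsymm : ∀ x y, ω x y = ω y x := fun x y => by
    have := h.isAlt.neg_eq x y
    rw [← this, ZMod.neg_eq_self_mod_two]
  have hterm : ∀ s, ω (e s) (e t) = if (edgeGraph ω e).Adj t s then 1 else 0 := by
    intro s
    have hadj : (edgeGraph ω e).Adj t s ↔ t ≠ s ∧ ω (e s) (e t) = 1 := by
      simp [edgeGraph, SimpleGraph.fromRel_adj, hsymm (e t) (e s)]
    rw [hadj]
    by_cases hts : t = s
    · subst hts
      simp [h.isAlt (e t)]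
    · have h01 : ∀ x : ZMod 2, x = if x = 1 then 1 else 0 := by decide
      simpa [hts] using h01 (ω (e s) (e t))
  obtain ⟨f⟩ := h.cycle
  have hdeg : (edgeGraph ω e).degree t = 2 := by
    rw [← f.degree_eq t]
    obtain ⟨n, hn⟩ := Nat.exists_eq_add_of_le' h.three_le
    generalize f t = v
    revert v
    rw [hn]
    intro v
    convert SimpleGraph.cycleGraph_degree_three_le (v := v)
  simp only [vecSum, map_sum, LinearMap.sum_apply, LinearMap.zero_apply, hterm]
  rw [Finset.sum_boole]
  have hc : (Finset.univ.filter fun s => (edgeGraph ω e).Adj t s).card = 2 := by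
    refine Eq.trans ?_ hdeg
    rw [← SimpleGraph.card_neighborFinset_eq_degree, SimpleGraph.neighborFinset_eq_filter]
  rw [hc]
  rfl

/-- The space `V̄ = V / F e_S`. -/
abbrev QuotV {S V : Type*} [Fintype S] [AddCommGroup V] [Module (ZMod 2) V]
    (e : Module.Basis S (ZMod 2) V) : Type _ :=
  V ⧸ Submodule.span (ZMod 2) {vecSum e Finset.univ}

/-- The family `ē_s = π(e_s)` in `V̄`. -/
def quotVec {S V : Type*} [Fintype S] [AddCommGroup V] [Module (ZMod 2) V]
    (e : Module.Basis S (ZMod 2) V) (s : S) : QuotV e :=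
  Submodule.Quotient.mk (e s)

/-- The form on `V̄ = V / F e_S` induced by `ω`. -/
def quotForm {S V : Type*} [Fintype S] [AddCommGroup V] [Module (ZMod 2) V]
    {ω : LinearMap.BilinForm (ZMod 2) V} {e : Module.Basis S (ZMod 2) V}
    (h : IsAffineCase ω e) : LinearMap.BilinForm (ZMod 2) (QuotV e) :=
  LinearMap.liftQ₂ _ _ ω
    (by
      rw [Submodule.span_singleton_le_iff_mem]
      exact h.total_mem_radical)
    (by
      rw [Submodule.span_singleton_le_iff_mem, LinearMap.mem_ker]
      ext y
      have h0 : ω (vecSum e Finset.univ) y = 0 := by simp [h.total_mem_radical]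
      have h1 := h.isAlt.neg_eq (vecSum e Finset.univ) y
      rw [h0, neg_zero] at h1
      simpa using h1.symm)

/-- The induced form is given on classes by `⟨π x, π y⟩ = ⟨x, y⟩`. -/
theorem quotForm_mk {S V : Type*} [Fintype S] [AddCommGroup V] [Module (ZMod 2) V]
    {ω : LinearMap.BilinForm (ZMod 2) V} {e : Module.Basis S (ZMod 2) V}
    (h : IsAffineCase ω e) (x y : V) :
    quotForm h (Submodule.Quotient.mk x : QuotV e) (Submodule.Quotient.mk y : QuotV e) = ω x y :=
  rfl

/-- The vector `[𝐞] = ē_{(S - 𝐞)^odd}` of `V̄`, for an edge `𝐞`. -/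
def edgeVec {S V : Type*} [Fintype S] [DecidableEq S] [AddCommGroup V] [Module (ZMod 2) V]
    {ω : LinearMap.BilinForm (ZMod 2) V} {e : Module.Basis S (ZMod 2) V}
    (h : IsAffineCase ω e) (edge : Sym2 S) : QuotV e :=
  vecSum (quotVec e) (oddPart (edgeGraph (quotForm h) (quotVec e)) (Finset.univ \ edge.toFinset))

end

/-! Each edge $\{s,t\}$ of the cycle gives a linear form on $\bar V$, the sum of the coordinates at
$s$ and $t$ (`coordAdd`). It kills $e_S$ in characteristic 2, and on $\bar e_I$ it is 1 exactly when
the edge crosses the boundary of $I$. As the cycle is connected, these forms separate the points of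
$\bar V$ (`eq_of_coordAdd_eq`), so everything reduces to counting crossings.

Every interval is crossed by exactly two edges (`card_crosses`). The main combinatorial fact is
`existsUnique_crosses`: an edge meeting supp(B) is crossed by exactly one member of B, with $(P_0)$
giving uniqueness and $(P_1)$ existence. Double counting gives $2|B| + |M| = N$, where $M$ is the
set of edges missing supp(B). Since $N$ is odd, $|M|\ge 1$, which is the bound, and equality holds
iff $|M| = 1$.

The vector $[\mathbf e]$ takes the value 1 on every edge except $\mathbf e$
(`crosses_oddPart_compl`), while $\sum_{I\in B} c_I\bar e_I$ takes the value $c_I$ on an edge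
crossed by $I$ and 0 on $M$. Equality forces all $c_I = 1$, and then says precisely that $M =
\{\mathbf e\}$. -/

/-- Two distinct elements of a preconnected set separated by `U` force an edge of the set that
crosses the boundary of `U`. -/
theorem exists_adj_of_induce_preconnected {S : Type*} {G : SimpleGraph S} {A : Set S}
    (h : (G.induce A).Preconnected) (U : Set S) {u v : S} (hu : u ∈ A) (hv : v ∈ A)
    (huU : u ∈ U) (hvU : v ∉ U) : ∃ s ∈ A, ∃ t ∈ A, s ∈ U ∧ t ∉ U ∧ G.Adj s t := by
  obtain ⟨w⟩ := h ⟨u, hu⟩ ⟨v, hv⟩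
  obtain ⟨d, -, h1, h2⟩ := w.exists_boundary_dart (Subtype.val ⁻¹' U) huU hvU
  exact ⟨d.fst, d.fst.2, d.snd, d.snd.2, h1, h2, d.adj⟩

/-! ### Integer parametrizations of the cycle, and arcs. -/

/-- `p : ℤ → S` winds around the graph `G`, a cycle with `N` vertices. -/
structure IsCyclicParam {S : Type*} (G : SimpleGraph S) (N : ℕ) (p : ℤ → S) : Prop where
  three_le : 3 ≤ N
  surj : Function.Surjective p
  eq_iff : ∀ i j, p i = p j ↔ (N : ℤ) ∣ i - j
  adj_iff : ∀ i j, G.Adj (p i) (p j) ↔ (N : ℤ) ∣ i - j - 1 ∨ (N : ℤ) ∣ i - j + 1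

/-- The set of `p i` for `a ≤ i < b`. -/
noncomputable def arc {S : Type*} [DecidableEq S] (p : ℤ → S) (a b : ℤ) : Finset S :=
  (Finset.Ico a b).image p

theorem mem_arc {S : Type*} [DecidableEq S] {p : ℤ → S} {a b : ℤ} {s : S} :
    s ∈ arc p a b ↔ ∃ i, (a ≤ i ∧ i < b) ∧ p i = s := by
  simp [arc]

namespace IsCyclicParam

variable {S : Type*} {G : SimpleGraph S} {N : ℕ} {p : ℤ → S}

theorem shift (hp : IsCyclicParam G N p) (a : ℤ) : IsCyclicParam G N fun i => p (a + i) where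
  three_le := hp.three_le
  surj s := by
    obtain ⟨i, rfl⟩ := hp.surj s
    exact ⟨i - a, by simp⟩
  eq_iff i j := by rw [hp.eq_iff, add_sub_add_left_eq_sub]
  adj_iff i j := by rw [hp.adj_iff, add_sub_add_left_eq_sub]

theorem neg (hp : IsCyclicParam G N p) : IsCyclicParam G N fun i => p (-i) where
  three_le := hp.three_le
  surj s := by
    obtain ⟨i, rfl⟩ := hp.surj s
    exact ⟨-i, by simp⟩
  eq_iff i j := by
    rw [hp.eq_iff, ← dvd_neg]
    ring_nf
  adj_iff i j := by
    rw [hp.adj_iff, ← dvd_neg, ← dvd_neg (b := -i - -j + 1), or_comm]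
    ring_nf

theorem adj_left_iff (hp : IsCyclicParam G N p) (i : ℤ) (t : S) :
    G.Adj (p i) t ↔ t = p (i + 1) ∨ t = p (i - 1) := by
  obtain ⟨j, rfl⟩ := hp.surj t
  rw [hp.adj_iff, hp.eq_iff, hp.eq_iff, show j - (i + 1) = -(i - j + 1) by ring,
    show j - (i - 1) = -(i - j - 1) by ring, dvd_neg, dvd_neg, or_comm]

theorem adj_succ (hp : IsCyclicParam G N p) (i : ℤ) : G.Adj (p i) (p (i + 1)) :=
  (hp.adj_left_iff _ _).2 (Or.inl rfl)

theorem eq_of_eq (hp : IsCyclicParam G N p) {i j : ℤ} (h : p i = p j) (h1 : i < j + N)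
    (h2 : j < i + N) : i = j := by
  have := Int.eq_zero_of_abs_lt_dvd ((hp.eq_iff i j).1 h) (abs_lt.2 ⟨by lia, by lia⟩)
  lia

theorem add_period (hp : IsCyclicParam G N p) (i : ℤ) : p (i + N) = p i :=
  (hp.eq_iff _ _).2 (by simp)

/-- An edge can be taken as the starting point of a parametrization. -/
theorem exists_of_adj (hp : IsCyclicParam G N p) {s t : S} (h : G.Adj s t) :
    ∃ q, IsCyclicParam G N q ∧ q 0 = s ∧ q (-1) = t := by
  obtain ⟨i, rfl⟩ := hp.surj s
  rcases (hp.adj_left_iff i t).1 h with rfl | rfl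
  · exact ⟨_, (hp.shift i).neg, by simp, by simp⟩
  · exact ⟨_, hp.shift i, by simp, by simp [sub_eq_add_neg]⟩

variable [DecidableEq S]

/-- In the window `b - N ≤ i < a + N`, the index `i` is less than `N` away from every index of `[a,
b)`, so no wrap-around can occur. -/
theorem mem_arc_iff (hp : IsCyclicParam G N p) {a b i : ℤ} (h1 : b - N ≤ i) (h2 : i < a + N) :
    p i ∈ arc p a b ↔ a ≤ i ∧ i < b := by
  rw [mem_arc]
  refine ⟨?_, fun h => ⟨i, h, rfl⟩⟩
  rintro ⟨j, hj, hji⟩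
  obtain rfl := hp.eq_of_eq hji (by lia) (by lia)
  exact hj

theorem card_arc (hp : IsCyclicParam G N p) {a b : ℤ} (h : b ≤ a + N) :
    (arc p a b).card = (b - a).toNat := by
  rw [arc, Finset.card_image_of_injOn, Int.card_Ico]
  intro i hi j hj hij
  simp only [Finset.coe_Ico, Set.mem_Ico] at hi hj
  exact hp.eq_of_eq hij (by lia) (by lia)

theorem arc_sdiff (hp : IsCyclicParam G N p) {a b c : ℤ} (hab : a ≤ b) (hbc : b ≤ c)
    (h : c ≤ a + N) : arc p a c \ arc p a b = arc p b c := by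
  ext s
  rw [Finset.mem_sdiff]
  constructor
  · rintro ⟨h1, h2⟩
    obtain ⟨i, hi, rfl⟩ := mem_arc.1 h1
    rw [hp.mem_arc_iff (by lia) (by lia)] at h2 ⊢
    lia
  · intro h1
    obtain ⟨i, hi, rfl⟩ := mem_arc.1 h1
    rw [hp.mem_arc_iff (by lia) (by lia), hp.mem_arc_iff (by lia) (by lia)]
    lia

theorem arc_preconnected (hp : IsCyclicParam G N p) (a b : ℤ) :
    (G.induce (arc p a b : Set S)).Preconnected := by
  have key : ∀ k : ℕ, ∀ h : p (a + k) ∈ (arc p a b : Set S), a + k < b →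
      ∀ h0 : p a ∈ (arc p a b : Set S),
      (G.induce (arc p a b : Set S)).Reachable ⟨p a, h0⟩ ⟨p (a + k), h⟩ := by
    intro k
    induction k with
    | zero =>
      intro h _ h0
      have : (⟨p a, h0⟩ : (arc p a b : Set S)) = ⟨p (a + (0 : ℕ)), h⟩ := by simp
      rw [← this]
    | succ k ih =>
      intro h hk h0
      have hm : p (a + k) ∈ (arc p a b : Set S) :=
        mem_arc.2 ⟨a + k, ⟨by lia, by lia⟩, rfl⟩
      refine (ih hm (by lia) h0).trans (SimpleGraph.Adj.reachable ?_)
      have := hp.adj_succ (a + k)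
      simpa [add_assoc] using this
  have key2 : ∀ x : (arc p a b : Set S), ∀ h0 : p a ∈ (arc p a b : Set S),
      (G.induce (arc p a b : Set S)).Reachable ⟨p a, h0⟩ x := by
    rintro ⟨x, hx⟩ h0
    obtain ⟨i, hi, rfl⟩ := mem_arc.1 (Finset.mem_coe.1 hx)
    obtain ⟨k, rfl⟩ : ∃ k : ℕ, i = a + k := ⟨(i - a).toNat, by lia⟩
    exact key k hx hi.2 h0
  intro x y
  have h0 : p a ∈ (arc p a b : Set S) := by
    obtain ⟨i, hi, -⟩ := mem_arc.1 (Finset.mem_coe.1 x.2)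
    exact mem_arc.2 ⟨a, ⟨le_rfl, by lia⟩, rfl⟩
  exact (key2 x h0).symm.trans (key2 y h0)

/-- A connected set is an arc starting at any of its boundary points. -/
theorem eq_arc (hp : IsCyclicParam G N p) {I : Finset S}
    (hI : (G.induce (I : Set S)).Preconnected) {a : ℤ} (ha : p a ∈ I) (ha' : p (a - 1) ∉ I) :
    ∃ b, a < b ∧ b < a + N ∧ I = arc p a b := by
  have h3 := hp.three_le
  -- The indices `a - 1` and `a + N - 1` name the same vertex, so a walk forward from `a` must leave
  -- `I` within `N - 1` steps.
  have hN : p (a + (N - 1 : ℕ)) ∉ I := by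
    have := hp.add_period (a - 1)
    rwa [← this, show a - 1 + (N : ℤ) = a + (N - 1 : ℕ) by lia] at ha'
  have hex : ∃ k : ℕ, p (a + k) ∉ I := ⟨_, hN⟩
  classical
  obtain ⟨k, hk, hmin⟩ : ∃ k : ℕ, p (a + k) ∉ I ∧ ∀ l < k, p (a + l) ∈ I :=
    ⟨Nat.find hex, Nat.find_spec hex, fun l hl => not_not.1 (Nat.find_min hex hl)⟩
  have hk0 : k ≠ 0 := by
    rintro rfl
    simp [ha] at hk
  have hkN : k ≤ N - 1 := by
    by_contra! hlt
    exact hN (hmin _ hlt)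
  refine ⟨a + k, by lia, by lia, (Finset.Subset.antisymm ?_ ?_)⟩
  -- An edge leaving the arc ends at index `a - 1` or `a + k`, both outside `I`; connectedness then
  -- leaves no room for further elements.
  · intro v hv
    by_contra hva
    obtain ⟨s, hs, t, ht, hsU, htU, hst⟩ := exists_adj_of_induce_preconnected hI
      (arc p a (a + k) : Set S) (u := p a) (v := v) ha hv
      (mem_arc.2 ⟨a, by lia, rfl⟩) hva
    obtain ⟨i, hi, rfl⟩ := mem_arc.1 (Finset.mem_coe.1 hsU)
    rcases (hp.adj_left_iff _ _).1 hst with rfl | rfl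
    · by_cases hik : i + 1 = a + k
      · exact hk (hik ▸ ht)
      · exact htU (mem_arc.2 ⟨i + 1, by lia, rfl⟩)
    · by_cases hia : i = a
      · exact ha' (hia ▸ ht)
      · exact htU (mem_arc.2 ⟨i - 1, by lia, rfl⟩)
  · intro v hv
    obtain ⟨i, hi, rfl⟩ := mem_arc.1 hv
    have := hmin (i - a).toNat (by lia)
    rwa [show a + ((i - a).toNat : ℤ) = i by lia] at this

theorem isInterval_arc (hp : IsCyclicParam G N p) {a b : ℤ} (hab : a < b) (hb : b < a + N) :
    IsInterval G (arc p a b) := by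
  have hmem : ∀ k : Fin (b - a).toNat, p (a + k) ∈ (arc p a b : Set S) := fun k =>
    mem_arc.2 ⟨a + k, by have := k.2; lia, rfl⟩
  refine ⟨(b - a).toNat, by lia, ⟨RelIso.symm ⟨Equiv.ofBijective
    (fun k => ⟨p (a + k), hmem k⟩) ⟨fun k l hkl => ?_, fun x => ?_⟩, @fun k l => ?_⟩⟩⟩
  · obtain ⟨k, hk⟩ := k
    obtain ⟨l, hl⟩ := l
    have := hp.eq_of_eq (i := a + (k : ℤ)) (j := a + (l : ℤ)) (Subtype.ext_iff.1 hkl)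
      (by lia) (by lia)
    exact Fin.ext (by simp only; lia)
  · obtain ⟨x, hx⟩ := x
    obtain ⟨i, hi, rfl⟩ := mem_arc.1 (Finset.mem_coe.1 hx)
    refine ⟨⟨(i - a).toNat, by lia⟩, Subtype.ext ?_⟩
    simp only
    congr 1
    lia
  · have hk := k.2
    have hl := l.2
    change G.Adj (p (a + k)) (p (a + l)) ↔ _
    rw [SimpleGraph.pathGraph_adj, hp.adj_iff]
    constructor
    · rintro (h | h)
      · have := Int.eq_zero_of_abs_lt_dvd h (abs_lt.2 ⟨by lia, by lia⟩)
        lia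
      · have := Int.eq_zero_of_abs_lt_dvd h (abs_lt.2 ⟨by lia, by lia⟩)
        lia
    · rintro (h | h)
      · right
        rw [show a + (k : ℤ) - (a + (l : ℤ)) + 1 = 0 by lia]
        exact dvd_zero _
      · left
        rw [show a + (k : ℤ) - (a + (l : ℤ)) - 1 = 0 by lia]
        exact dvd_zero _

theorem isOddInterval_arc (hp : IsCyclicParam G N p) {a b : ℤ} (hab : a < b) (hb : b < a + N)
    (hodd : Odd (b - a)) : IsOddInterval G (arc p a b) := by
  refine ⟨hp.isInterval_arc hab hb, ?_⟩
  rw [hp.card_arc hb.le]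
  obtain ⟨k, hk⟩ := hodd
  exact ⟨k.toNat, by lia⟩

end IsCyclicParam

/-! ### Intervals as arcs, the relations ♠ and ≺, and the even part. -/

theorem IsInterval.preconnected {S : Type*} {G : SimpleGraph S} {I : Finset S}
    (h : IsInterval G I) : (G.induce (I : Set S)).Preconnected := by
  obtain ⟨m, -, ⟨f⟩⟩ := h
  exact f.preconnected_iff.2 (SimpleGraph.pathGraph_preconnected m)

theorem IsInterval.nonempty {S : Type*} {G : SimpleGraph S} {I : Finset S}
    (h : IsInterval G I) : I.Nonempty := by
  obtain ⟨m, hm, ⟨f⟩⟩ := h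
  exact ⟨_, (f.symm ⟨0, hm⟩).2⟩

/-- Adjacent intervals are not in the relation `♠`. -/
theorem Spade.not_adj {S : Type*} [DecidableEq S] {G : SimpleGraph S} {I J : Finset S}
    (h : Spade G I J) (hI : IsInterval G I) (hJ : IsInterval G J) {s t : S} (hs : s ∈ I)
    (ht : t ∈ J) : ¬ G.Adj s t := fun hst => by
  apply h.2
  rw [Finset.coe_union]
  exact (SimpleGraph.connected_induce_union hI.preconnected hJ.preconnected hs ht hst).preconnected

namespace IsCyclicParam

variable {S : Type*} {G : SimpleGraph S} {N : ℕ} {p : ℤ → S}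

/-- The whole cycle is not a path. -/
theorem exists_notMem (hp : IsCyclicParam G N p) {I : Finset S} (hI : IsInterval G I) :
    ∃ s, s ∉ I := by
  by_contra! hall
  obtain ⟨m, hm, ⟨f⟩⟩ := hI
  obtain ⟨i, hi⟩ := hp.surj (f.symm ⟨0, hm⟩)
  have h3 := hp.three_le
  -- The first vertex of a path has at most one neighbour in it, but in the cycle it has two
  -- distinct ones.
  have key : ∀ j (hj : p j ∈ (I : Set S)), G.Adj (p i) (p j) → (f ⟨p j, hj⟩ : ℕ) = 1 := by
    intro j hj hadj
    have h1 : (G.induce (I : Set S)).Adj (f.symm ⟨0, hm⟩) ⟨p j, hj⟩ := by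
      simpa [← hi] using hadj
    have h2 := f.map_adj_iff.2 h1
    rw [RelIso.apply_symm_apply, SimpleGraph.pathGraph_adj] at h2
    simp only at h2
    lia
  have h1 := key (i + 1) (hall _) (hp.adj_succ i)
  have h2 := key (i - 1) (hall _) ((hp.adj_left_iff _ _).2 (Or.inr rfl))
  have h4 := f.injective (Fin.ext (h1.trans h2.symm))
  have := hp.eq_of_eq (Subtype.ext_iff.1 h4) (by lia) (by lia)
  lia

/-- An interval has a boundary edge. -/
theorem exists_boundary (hp : IsCyclicParam G N p) {I : Finset S} (hI : IsInterval G I) :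
    ∃ s ∈ I, ∃ t ∉ I, G.Adj s t := by
  obtain ⟨u, hu⟩ := hI.nonempty
  obtain ⟨v, hv⟩ := hp.exists_notMem hI
  obtain ⟨i, rfl⟩ := hp.surj u
  by_contra! hno
  -- Without a boundary edge, `I` is closed under successors, hence is the whole cycle.
  have hstep : ∀ k : ℕ, p (i + k) ∈ I := by
    intro k
    induction k with
    | zero => simpa using hu
    | succ k ih =>
      by_contra hk
      refine hno _ ih _ hk ?_
      have := hp.adj_succ (i + k)
      simpa [add_assoc] using this
  obtain ⟨j, rfl⟩ := hp.surj v
  have h3 := hp.three_le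
  apply hv
  have : p j = p (i + ((j - i) % N).toNat) := by
    rw [hp.eq_iff, Int.toNat_of_nonneg (Int.emod_nonneg _ (by lia))]
    have := Int.dvd_self_sub_emod (x := j - i) (m := (N : ℤ))
    rwa [sub_add_eq_sub_sub]
  rw [this]
  exact hstep _

variable [DecidableEq S]

/-- An interval is an arc for a suitable parametrization. -/
theorem exists_eq_arc (hp : IsCyclicParam G N p) {I : Finset S} (hI : IsInterval G I) {s t : S}
    (hs : s ∈ I) (ht : t ∉ I) (hst : G.Adj s t) :
    ∃ q, IsCyclicParam G N q ∧ q 0 = s ∧ q (-1) = t ∧ ∃ m : ℤ, 0 < m ∧ m < N ∧ I = arc q 0 m := by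
  obtain ⟨q, hq, rfl, rfl⟩ := hp.exists_of_adj hst
  obtain ⟨m, h1, h2, h3⟩ := hq.eq_arc hI.preconnected hs ht
  exact ⟨q, hq, rfl, rfl, m, h1, by lia, h3⟩

/-- If `I ≺ J`, then `J` contains the neighbours of `I`. -/
theorem mem_of_prec (hp : IsCyclicParam G N p) {I J : Finset S} (hI : IsInterval G I)
    (hJ : IsInterval G J) (h : Prec G I J) {s t : S} (hs : s ∈ I) (hst : G.Adj s t) : t ∈ J := by
  by_contra ht
  -- If `t ∉ J`, then `I` and `J` are arcs with the same starting point, so `J \ I` is again an arc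
  -- and hence connected, against `I ≺ J`.
  obtain ⟨q, hq, rfl, rfl, m, hm, hmN, hJm⟩ := hp.exists_eq_arc hJ (h.1.1 hs) ht hst
  obtain ⟨k, hk, hkN, hIk⟩ := hq.eq_arc hI.preconnected (a := 0) hs (fun h' => ht (h.1.1 h'))
  have hkm : k ≤ m := by
    by_contra! hlt
    apply h.1.2
    intro x hx
    rw [hJm] at hx
    obtain ⟨i, hi, rfl⟩ := mem_arc.1 hx
    rw [hIk]
    exact mem_arc.2 ⟨i, by lia, rfl⟩
  apply h.2
  rw [hJm, hIk, hq.arc_sdiff hk.le hkm (by lia)]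
  exact hq.arc_preconnected k m

/-- For an arc of odd size `m`, the even part consists of the vertices with odd index. -/
theorem mem_evPart_arc (hp : IsCyclicParam G N p) {m : ℤ} (hmN : m + 1 < N) (hm : Odd m) {i : ℤ}
    (hi : 0 ≤ i) (him : i < m) : p i ∈ evPart G (arc p 0 m) ↔ Odd i := by
  simp only [evPart, Finset.mem_filter]
  have hmem : ∀ {a b j : ℤ}, 0 ≤ a → b ≤ m → -1 ≤ j → j ≤ m → (p j ∈ arc p a b ↔ a ≤ j ∧ j < b) :=
    fun ha hb hj hj' => hp.mem_arc_iff (by lia) (by lia)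
  constructor
  · rintro ⟨-, I', I'', h1, h2, hu, hsp⟩
    have hmemU : ∀ j, -1 ≤ j → j ≤ m → (p j ∈ I' ∪ I'' ↔ (0 ≤ j ∧ j < m) ∧ j ≠ i) := by
      intro j hj hj'
      rw [← hu, Finset.mem_sdiff, hmem le_rfl le_rfl hj hj', Finset.mem_singleton, and_congr_right_iff]
      intro _
      rw [not_iff_not]
      exact ⟨fun h => hp.eq_of_eq h (by lia) (by lia), fun h => h ▸ rfl⟩
    -- The piece starting at `a` must stop at the removed index `i` or at the end `m`: anywhere
    -- else, the next vertex would lie in the other piece and be adjacent to this one.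
    have hkey : ∀ a, 0 ≤ a → a ≤ 1 → a ≠ i → p (a - 1) ∉ I' ∪ I'' → a < m → ∀ K K' : Finset S,
        IsOddInterval G K → IsOddInterval G K' → I' ∪ I'' = K ∪ K' → Spade G K K' → p a ∈ K →
        ∃ b, a < b ∧ b ≤ m ∧ K = arc p a b ∧ (b = i ∨ b = m) ∧ Odd (b - a) := by
      intro a ha ha1 hai hna ham K K' hK hK' hKK hs haK
      obtain ⟨b, hab, hbN, rfl⟩ := hp.eq_arc hK.1.preconnected haK
        (fun h => hna (hKK ▸ Finset.mem_union_left _ h))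
      have hbm : b ≤ m := by
        by_contra! hlt
        have h' : p m ∈ I' ∪ I'' := by
          rw [hKK]
          exact Finset.mem_union_left _ (mem_arc.2 ⟨m, by lia, rfl⟩)
        have := (hmemU m (by lia) le_rfl).1 h'
        lia
      refine ⟨b, hab, hbm, rfl, ?_, ?_⟩
      · by_contra! hb
        have hbU := (hmemU b (by lia) hbm).2 (by lia)
        rw [hKK, Finset.mem_union, hmem ha hbm (by lia) hbm] at hbU
        have hbK' : p b ∈ K' := by
          rcases hbU with h | h
          · lia
          · exact h
        refine hs.not_adj hK.1 hK'.1 (s := p (b - 1)) (mem_arc.2 ⟨b - 1, by lia, rfl⟩) hbK' ?_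
        have := hp.adj_succ (b - 1)
        rwa [sub_add_cancel] at this
      · have := hK.2
        rw [hp.card_arc hbN.le] at this
        obtain ⟨c, hc⟩ := this
        exact ⟨c, by lia⟩
    have hkey' : ∀ a, 0 ≤ a → a ≤ 1 → a ≠ i → p (a - 1) ∉ I' ∪ I'' → a < m →
        ∃ K K' : Finset S, ∃ b, IsOddInterval G K' ∧ I' ∪ I'' = K ∪ K' ∧ Spade G K K' ∧
        a < b ∧ b ≤ m ∧ K = arc p a b ∧ (b = i ∨ b = m) ∧ Odd (b - a) := by
      intro a ha ha1 hai hna ham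
      have haU := (hmemU a (by lia) ham.le).2 (by lia)
      rcases Finset.mem_union.1 haU with h | h
      · obtain ⟨b, hb⟩ := hkey a ha ha1 hai hna ham I' I'' h1 h2 rfl hsp h
        exact ⟨I', I'', b, h2, rfl, hsp, hb⟩
      · have hsp' : Spade G I'' I' :=
          ⟨hsp.1.symm, by rw [Finset.union_comm]; exact hsp.2⟩
        obtain ⟨b, hb⟩ := hkey a ha ha1 hai hna ham I'' I' h2 h1 (Finset.union_comm _ _) hsp' h
        exact ⟨I'', I', b, h1, Finset.union_comm _ _, hsp', hb⟩
    -- Removing index 0 leaves `m - 1` vertices, an even number: either none, or a run that a single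
    -- odd piece would have to fill.
    by_cases hi0 : i = 0
    · exfalso
      subst hi0
      by_cases hm1 : m = 1
      · obtain ⟨x, hx⟩ := h1.1.nonempty
        have hx' := Finset.mem_union_left I'' hx
        rw [← hu, Finset.mem_sdiff, Finset.mem_singleton] at hx'
        obtain ⟨j, hj, rfl⟩ := mem_arc.1 hx'.1
        obtain rfl : j = 0 := by lia
        exact hx'.2 rfl
      · obtain ⟨K, K', b, -, -, -, hb1, -, -, hb, hodd⟩ := hkey' 1 (by lia) le_rfl (by lia)
          (by rw [hmemU _ (by lia) (by lia)]; lia) (by lia)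
        obtain ⟨c, hc⟩ := hm
        obtain ⟨d, hd⟩ := hodd
        lia
    · obtain ⟨K, K', b, hK', hKK, hs, hab, hbm, rfl, hb, hodd⟩ := hkey' 0 le_rfl (by lia)
        (Ne.symm hi0) (by rw [hmemU _ (by lia) (by lia)]; lia) (by lia)
      -- The piece starting at 0 ends at `i`, so its odd length is `i` itself; if it ran on to `m`,
      -- it would contain the removed vertex.
      rcases hb with rfl | rfl
      · simpa using hodd
      · have := (hmemU i (by lia) (by lia)).1 (by
          rw [hKK]; exact Finset.mem_union_left _ (mem_arc.2 ⟨i, by lia, rfl⟩))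
        lia
  · intro hodd
    obtain ⟨c, hc⟩ := hodd
    obtain ⟨d, hd⟩ := hm
    refine ⟨mem_arc.2 ⟨i, by lia, rfl⟩, arc p 0 i, arc p (i + 1) m,
      hp.isOddInterval_arc (by lia) (by lia) ⟨c, by lia⟩,
      hp.isOddInterval_arc (by lia) (by lia) ⟨d - c - 1, by lia⟩, ?_, ?_, ?_⟩
    · ext x
      rw [Finset.mem_sdiff, Finset.mem_singleton, Finset.mem_union]
      constructor
      · rintro ⟨h1, h2⟩
        obtain ⟨j, hj, rfl⟩ := mem_arc.1 h1
        rw [hmem (by lia) (by lia) (by lia) (by lia), hmem (by lia) (by lia) (by lia) (by lia)]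
        have : j ≠ i := by rintro rfl; exact h2 rfl
        lia
      · rintro (h | h) <;>
        · obtain ⟨j, hj, rfl⟩ := mem_arc.1 h
          refine ⟨mem_arc.2 ⟨j, by lia, rfl⟩, fun h' => ?_⟩
          have := hp.eq_of_eq h' (by lia) (by lia)
          lia
    · rw [Finset.disjoint_left]
      intro x hx
      obtain ⟨j, hj, rfl⟩ := mem_arc.1 hx
      rw [hmem (by lia) (by lia) (by lia) (by lia)]
      lia
    · intro hcon
      -- An edge leaving the first piece ends at index `i` or `-1`. Neither lies in the union; for
      -- `-1` this uses `m + 1 < N`.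
      obtain ⟨s, hs, t, ht, hsU, htU, hst⟩ := exists_adj_of_induce_preconnected hcon
        (arc p 0 i : Set S) (u := p 0) (v := p (i + 1))
        (Finset.mem_union_left _ (mem_arc.2 ⟨0, by lia, rfl⟩))
        (Finset.mem_union_right _ (mem_arc.2 ⟨i + 1, by lia, rfl⟩))
        (mem_arc.2 ⟨0, by lia, rfl⟩)
        (by rw [Finset.mem_coe, hmem (by lia) (by lia) (by lia) (by lia)]; lia)
      obtain ⟨j, hj, rfl⟩ := mem_arc.1 (Finset.mem_coe.1 hsU)
      rcases (hp.adj_left_iff _ _).1 hst with rfl | rfl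
      · rw [Finset.mem_coe, Finset.mem_union, hmem (by lia) (by lia) (by lia) (by lia),
          hmem (by lia) (by lia) (by lia) (by lia)] at ht
        rw [Finset.mem_coe, hmem (by lia) (by lia) (by lia) (by lia)] at htU
        lia
      · rw [Finset.mem_coe, Finset.mem_union, hmem (by lia) (by lia) (by lia) (by lia),
          hmem (by lia) (by lia) (by lia) (by lia)] at ht
        rw [Finset.mem_coe, hmem (by lia) (by lia) (by lia) (by lia)] at htU
        lia

end IsCyclicParam

/-! ### Edges crossing an interval, and the count of crossings. -/

/-- The pair `z` has one element in `I` and one outside. -/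
def Crosses {S : Type*} (I : Finset S) (z : Sym2 S) : Prop :=
  (∃ s ∈ z, s ∈ I) ∧ ∃ t ∈ z, t ∉ I

theorem crosses_mk {S : Type*} {I : Finset S} {s t : S} :
    Crosses I s(s, t) ↔ ¬ (s ∈ I ↔ t ∈ I) := by
  simp only [Crosses, Sym2.mem_iff, exists_eq_or_imp, exists_eq_left]
  tauto

namespace IsCyclicParam

variable {S : Type*} {G : SimpleGraph S} {N : ℕ} {p : ℤ → S} [DecidableEq S]

open Classical in
/-- Exactly two edges leave an interval. -/
theorem card_crosses [Fintype S] (hp : IsCyclicParam G N p) {I : Finset S}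
    (hI : IsInterval G I) : (G.edgeFinset.filter (Crosses I)).card = 2 := by
  obtain ⟨s, hs, t, ht, hst⟩ := hp.exists_boundary hI
  obtain ⟨q, hq, rfl, rfl, m, hm, hmN, rfl⟩ := hp.exists_eq_arc hI hs ht hst
  have h3 := hq.three_le
  -- The crossing edges are those at the two ends of the arc.
  have hset : G.edgeFinset.filter (Crosses (arc q 0 m)) =
      {s(q 0, q (-1)), s(q (m - 1), q m)} := by
    ext z
    induction z with
    | _ s t =>
    wlog hsI : s ∈ arc q 0 m generalizing s t
    · by_cases htI : t ∈ arc q 0 m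
      · rw [Sym2.eq_swap]
        exact this t s htI
      · have h1 : q 0 ∈ arc q 0 m := mem_arc.2 ⟨0, ⟨le_rfl, hm⟩, rfl⟩
        have h2 : q (m - 1) ∈ arc q 0 m := mem_arc.2 ⟨m - 1, ⟨by lia, by lia⟩, rfl⟩
        simp only [Finset.mem_filter, crosses_mk, hsI, htI, Finset.mem_insert,
          Finset.mem_singleton, Sym2.eq_iff]
        aesop
    · rw [Finset.mem_filter, SimpleGraph.mem_edgeFinset, SimpleGraph.mem_edgeSet, crosses_mk]
      simp only [hsI, true_iff, Finset.mem_insert, Finset.mem_singleton, Sym2.eq_iff]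
      obtain ⟨i, hi, rfl⟩ := mem_arc.1 hsI
      have hmN' : q m ∉ arc q 0 m := by
        rw [hq.mem_arc_iff (by lia) (by lia)]
        lia
      constructor
      · rintro ⟨h1, h2⟩
        rcases (hq.adj_left_iff _ _).1 h1 with rfl | rfl
        · rw [hq.mem_arc_iff (by lia) (by lia)] at h2
          obtain rfl : i = m - 1 := by lia
          right; left
          simp
        · rw [hq.mem_arc_iff (by lia) (by lia)] at h2
          obtain rfl : i = 0 := by lia
          left; left
          simp
      · rintro ((⟨h1, rfl⟩ | ⟨h1, -⟩) | (⟨h1, rfl⟩ | ⟨h1, -⟩))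
        · exact ⟨h1 ▸ hst, ht⟩
        · exact absurd hsI (h1 ▸ ht)
        · refine ⟨h1 ▸ ?_, hmN'⟩
          have := hq.adj_succ (m - 1)
          rwa [sub_add_cancel] at this
        · exact absurd hsI (h1 ▸ hmN')
  rw [hset, Finset.card_pair]
  rw [Ne, Sym2.eq_iff]
  rintro (⟨h1, h2⟩ | ⟨h1, h2⟩)
  · have e1 := hq.eq_of_eq h1 (by lia) (by lia)
    have e2 := hq.eq_of_eq h2 (by lia) (by lia)
    lia
  · rw [← hq.add_period (-1)] at h2
    have e1 : 0 = m ∨ m = N := by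
      by_contra! hne
      exact hne.1 (hq.eq_of_eq h1 (by lia) (by lia))
    lia

open Classical in
theorem card_edgeFinset [Fintype S] (hp : IsCyclicParam G N p) :
    G.edgeFinset.card = Fintype.card S := by
  have h3 := hp.three_le
  have hdeg : ∀ s, G.degree s = 2 := by
    intro s
    obtain ⟨i, rfl⟩ := hp.surj s
    rw [← SimpleGraph.card_neighborFinset_eq_degree]
    have : G.neighborFinset (p i) = {p (i + 1), p (i - 1)} := by
      ext t
      rw [SimpleGraph.mem_neighborFinset, hp.adj_left_iff]
      simp
    rw [this, Finset.card_pair]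
    intro h
    have := hp.eq_of_eq h (by lia) (by lia)
    lia
  have := G.sum_degrees_eq_twice_card_edges
  simp only [hdeg, Finset.sum_const, Finset.card_univ, smul_eq_mul] at this
  lia

/-- An interval has at most `N - 1` vertices, and `N - 1` is even. The resulting gap of at least two
vertices keeps the outer neighbours of the two ends distinct. -/
theorem card_add_one_lt (hp : IsCyclicParam G N p) (hN : Odd N) {I : Finset S}
    (hI : IsOddInterval G I) : I.card + 1 < N := by
  obtain ⟨s, hs, t, ht, hst⟩ := hp.exists_boundary hI.1
  obtain ⟨q, hq, rfl, rfl, m, hm, hmN, rfl⟩ := hp.exists_eq_arc hI.1 hs ht hst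
  have h2 := hI.2
  rw [hq.card_arc (by lia)] at h2 ⊢
  obtain ⟨k, hk⟩ := hN
  obtain ⟨l, hl⟩ := h2
  lia

/-- An odd interval is an arc of odd size less than `N - 1`. -/
theorem exists_eq_arc_of_odd (hp : IsCyclicParam G N p) (hN : Odd N) {I : Finset S}
    (hI : IsOddInterval G I) : ∃ q, IsCyclicParam G N q ∧
    ∃ m : ℤ, 0 < m ∧ m + 1 < N ∧ Odd m ∧ I = arc q 0 m := by
  obtain ⟨s, hs, t, ht, hst⟩ := hp.exists_boundary hI.1
  obtain ⟨q, hq, rfl, rfl, m, hm, hmN, rfl⟩ := hp.exists_eq_arc hI.1 hs ht hst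
  have h1 := hI.2
  have h2 := hp.card_add_one_lt hN hI
  rw [hq.card_arc (by lia)] at h1 h2
  obtain ⟨l, hl⟩ := h1
  exact ⟨q, hq, m, hm, by lia, ⟨l, by lia⟩, rfl⟩

/-- Exactly one of two adjacent vertices of an odd interval is in its even part. -/
theorem mem_evPart_iff_of_adj (hp : IsCyclicParam G N p) (hN : Odd N) {I : Finset S}
    (hI : IsOddInterval G I) {s t : S} (hs : s ∈ I) (ht : t ∈ I) (hst : G.Adj s t) :
    s ∈ evPart G I ↔ t ∉ evPart G I := by
  obtain ⟨q, hq, m, hm, hmN, hodd, rfl⟩ := hp.exists_eq_arc_of_odd hN hI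
  obtain ⟨i, hi, rfl⟩ := mem_arc.1 hs
  rcases (hq.adj_left_iff _ _).1 hst with rfl | rfl
  · rw [hq.mem_arc_iff (by lia) (by lia)] at ht
    rw [hq.mem_evPart_arc hmN hodd hi.1 hi.2, hq.mem_evPart_arc hmN hodd ht.1 ht.2]
    simp [parity_simps]
  · rw [hq.mem_arc_iff (by lia) (by lia)] at ht
    rw [hq.mem_evPart_arc hmN hodd hi.1 hi.2, hq.mem_evPart_arc hmN hodd ht.1 ht.2]
    simp [parity_simps]

/-- An endpoint of an odd interval is not in its even part. -/
theorem notMem_evPart_of_adj (hp : IsCyclicParam G N p) (hN : Odd N) {I : Finset S}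
    (hI : IsOddInterval G I) {s t : S} (hs : s ∈ I) (ht : t ∉ I) (hst : G.Adj s t) :
    s ∉ evPart G I := by
  obtain ⟨q, hq, m, hm, hmN, hodd, rfl⟩ := hp.exists_eq_arc_of_odd hN hI
  obtain ⟨i, hi, rfl⟩ := mem_arc.1 hs
  rw [hq.mem_evPart_arc hmN hodd hi.1 hi.2]
  obtain ⟨l, hl⟩ := hodd
  rcases (hq.adj_left_iff _ _).1 hst with rfl | rfl
  · rw [hq.mem_arc_iff (by lia) (by lia)] at ht
    rintro ⟨k, hk⟩
    lia
  · rw [hq.mem_arc_iff (by lia) (by lia)] at ht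
    rintro ⟨k, hk⟩
    lia

/-- The complement of an edge is an odd interval. -/
theorem isOddInterval_compl [Fintype S] (hp : IsCyclicParam G N p) (hN : Odd N) {s t : S}
    (hst : G.Adj s t) : IsOddInterval G (Finset.univ \ s(s, t).toFinset) := by
  have h3 := hp.three_le
  obtain ⟨q, hq, rfl, rfl⟩ := hp.exists_of_adj hst
  -- The removed indices are 0 and `-1 ≡ N - 1`, leaving `N - 2` consecutive vertices, an odd
  -- number.
  have : Finset.univ \ s(q 0, q (-1)).toFinset = arc q 1 (N - 1) := by
    ext x
    obtain ⟨i, rfl⟩ := hq.surj x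
    have h0 : (0 : ℤ) ≤ i % N := Int.emod_nonneg _ (by lia)
    have h1 : i % N < N := Int.emod_lt_of_pos _ (by lia)
    have h2 : q i = q (i % N) := by
      rw [hq.eq_iff]
      exact Int.dvd_self_sub_emod
    rw [h2]
    generalize i % N = j at h0 h1
    have h4 : q (-1) = q (N - 1) := by
      rw [← hq.add_period (-1)]
      congr 1
    rw [hq.mem_arc_iff (by lia) (by lia), h4]
    simp only [Finset.mem_sdiff, Finset.mem_univ, true_and, Sym2.mem_toFinset, Sym2.mem_iff]
    constructor
    · intro h
      have h5 : j ≠ 0 := by rintro rfl; simp at h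
      have h6 : j ≠ N - 1 := by rintro rfl; simp at h
      lia
    · rintro h (h' | h')
      · have := hq.eq_of_eq h' (by lia) (by lia)
        lia
      · have := hq.eq_of_eq h' (by lia) (by lia)
        lia
  rw [this]
  obtain ⟨k, hk⟩ := hN
  exact hq.isOddInterval_arc (by lia) (by lia) ⟨k - 1, by lia⟩

/-- The odd part of the complement of an edge `f` is crossed by every edge except `f`. -/
theorem crosses_oddPart_compl [Fintype S] (hp : IsCyclicParam G N p) (hN : Odd N) {f z : Sym2 S}
    (hf : f ∈ G.edgeSet) (hz : z ∈ G.edgeSet) :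
    Crosses (oddPart G (Finset.univ \ f.toFinset)) z ↔ z ≠ f := by
  induction f with | _ a b =>
  induction z with | _ s t =>
  rw [SimpleGraph.mem_edgeSet] at hf hz
  have hI := hp.isOddInterval_compl hN hf
  have hmem : ∀ x, x ∈ Finset.univ \ s(a, b).toFinset ↔ ¬ (x = a ∨ x = b) := by
    intro x
    simp
  generalize Finset.univ \ s(a, b).toFinset = I at hI hmem
  rw [crosses_mk, oddPart, Finset.mem_sdiff, Finset.mem_sdiff]
  -- Inside `I` parity alternates along the edge; at an end of `I` the inner vertex is in the odd
  -- part; an edge with no vertex in `I` is the removed edge itself.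
  by_cases hs : s ∈ I <;> by_cases ht : t ∈ I
  · have h1 := hp.mem_evPart_iff_of_adj hN hI hs ht hz
    have h2 : s(s, t) ≠ s(a, b) := by
      rw [hmem] at hs
      rw [Ne, Sym2.eq_iff]
      tauto
    simp only [hs, ht, h1]
    tauto
  · have h1 := hp.notMem_evPart_of_adj hN hI hs ht hz
    have h2 : s(s, t) ≠ s(a, b) := by
      rw [hmem] at hs
      rw [Ne, Sym2.eq_iff]
      tauto
    simp [hs, ht, h1, h2]
  · have h1 := hp.notMem_evPart_of_adj hN hI ht hs hz.symm
    have h2 : s(s, t) ≠ s(a, b) := by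
      rw [hmem] at ht
      rw [Ne, Sym2.eq_iff]
      tauto
    simp [hs, ht, h1, h2]
  · have h2 : s(s, t) = s(a, b) := by
      rw [hmem, not_not] at hs ht
      have := hz.ne
      rw [Sym2.eq_iff]
      grind
    simp [hs, ht, h2]

/-- An edge that meets the support of `B` is crossed by exactly one element of `B`. -/
theorem existsUnique_crosses (hp : IsCyclicParam G N p) (hN : Odd N) {B : Finset (Finset S)}
    (hB : ∀ I ∈ B, IsOddInterval G I) (h0 : CondP0 G B) (h1 : CondP1 G B) {z : Sym2 S}
    (hz : z ∈ G.edgeSet) (hsupp : ∃ s ∈ z, s ∈ supp B) : ∃! I, I ∈ B ∧ Crosses I z := by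
  -- Uniqueness from `(P₀)`: ♠ forbids adjacency between `I` and `J`, and under ≺ the larger
  -- interval contains all neighbours of the smaller one, so it is not crossed.
  have hunion : ∀ I ∈ B, ∀ J ∈ B, ∀ s t, G.Adj s t → s ∈ I → t ∉ I → ¬ (s ∈ J ↔ t ∈ J) →
      I = J := by
    intro I hI J hJ s t hst hs ht hJst
    rcases h0 I hI J hJ with h | h | h | h
    · exact h
    · by_cases hsJ : s ∈ J
      · exact absurd hsJ (Finset.disjoint_left.1 h.1 hs)
      · have htJ : t ∈ J := by tauto
        exact absurd hst (h.not_adj (hB I hI).1 (hB J hJ).1 hs htJ)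
    · have h2 := hp.mem_of_prec (hB I hI).1 (hB J hJ).1 h hs hst
      have h3 := h.1.1 hs
      tauto
    · by_cases hsJ : s ∈ J
      · exact absurd (hp.mem_of_prec (hB J hJ).1 (hB I hI).1 h hsJ hst) ht
      · have htJ : t ∈ J := by tauto
        exact absurd (h.1.1 htJ) ht
  induction z with | _ s t =>
  rw [SimpleGraph.mem_edgeSet] at hz
  have hex : ∃ I ∈ B, Crosses I s(s, t) := by
    by_contra! hno
    have hno' : ∀ I ∈ B, (s ∈ I ↔ t ∈ I) := fun I hI => by
      have := hno I hI
      rwa [crosses_mk, not_not] at this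
    obtain ⟨I₀, hI₀, hsI₀⟩ : ∃ I ∈ B, s ∈ I := by
      obtain ⟨x, hx, hxs⟩ := hsupp
      simp only [supp, Finset.mem_biUnion, id] at hxs
      obtain ⟨I, hI, hxI⟩ := hxs
      refine ⟨I, hI, ?_⟩
      rcases Sym2.mem_iff.1 hx with rfl | rfl
      · exact hxI
      · exact (hno' I hI).2 hxI
    -- Existence from `(P₁)`: if nothing is crossed, a smallest member containing `s` also contains
    -- `t`. One of the two is in its even part, hence in a strictly smaller member, which then
    -- contains `s` as well.
    obtain ⟨I, hImem, hmin⟩ := Finset.exists_min_image (B.filter (s ∈ ·)) Finset.card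
      ⟨I₀, Finset.mem_filter.2 ⟨hI₀, hsI₀⟩⟩
    obtain ⟨hI, hsI⟩ := Finset.mem_filter.1 hImem
    have htI := (hno' I hI).1 hsI
    have hev := hp.mem_evPart_iff_of_adj hN (hB I hI) hsI htI hz
    obtain ⟨C, hC, -, hcov, hprec⟩ := h1 I hI
    obtain ⟨J, hJ, hsJ⟩ : ∃ J ∈ C, s ∈ J := by
      by_cases hs : s ∈ evPart G I
      · have := hcov hs
        simpa [supp] using this
      · have ht : t ∈ evPart G I := by tauto
        have := hcov ht
        simp only [supp, Finset.mem_biUnion, id] at this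
        obtain ⟨J, hJ, htJ⟩ := this
        exact ⟨J, hJ, (hno' J (hC hJ)).2 htJ⟩
    have h2 := hmin J (Finset.mem_filter.2 ⟨hC hJ, hsJ⟩)
    have h3 := Finset.card_lt_card (hprec J hJ).1
    lia
  obtain ⟨I, hI, hIc⟩ := hex
  refine ⟨I, ⟨hI, hIc⟩, ?_⟩
  rintro J ⟨hJ, hJc⟩
  rw [crosses_mk] at hIc hJc
  by_cases hs : s ∈ I
  · exact (hunion I hI J hJ s t hz hs (by tauto) hJc).symm
  · exact (hunion I hI J hJ t s hz.symm (by tauto) hs (by tauto)).symm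

open Classical in
/-- Twice the number of elements of `B` is the number of edges that meet its support. -/
theorem two_mul_card [Fintype S] (hp : IsCyclicParam G N p) (hN : Odd N) {B : Finset (Finset S)}
    (hB : ∀ I ∈ B, IsOddInterval G I) (h0 : CondP0 G B) (h1 : CondP1 G B) :
    2 * B.card = (G.edgeFinset.filter fun z => ∃ s ∈ z, s ∈ supp B).card := by
  -- Pairs (interval of `B`, edge crossing it) are counted in two ways.
  have h := Finset.sum_card_bipartiteAbove_eq_sum_card_bipartiteBelow
    (s := B) (t := G.edgeFinset) Crosses
  have hl : ∀ I ∈ B, (G.edgeFinset.bipartiteAbove Crosses I).card = 2 := fun I hI =>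
    hp.card_crosses (hB I hI).1
  have hr : ∀ z ∈ G.edgeFinset, (B.bipartiteBelow Crosses z).card =
      if ∃ s ∈ z, s ∈ supp B then 1 else 0 := by
    intro z hz
    rw [SimpleGraph.mem_edgeFinset] at hz
    split_ifs with hs
    · rw [Finset.card_eq_one]
      obtain ⟨I, hI, huniq⟩ := hp.existsUnique_crosses hN hB h0 h1 hz hs
      refine ⟨I, ?_⟩
      ext J
      rw [Finset.bipartiteBelow, Finset.mem_filter, Finset.mem_singleton]
      exact ⟨fun hJ => huniq J hJ, fun hJ => hJ ▸ hI⟩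
    · rw [Finset.card_eq_zero, Finset.bipartiteBelow, Finset.filter_eq_empty_iff]
      rintro I hI ⟨⟨s, hsz, hsI⟩, -⟩
      exact hs ⟨s, hsz, Finset.mem_biUnion.2 ⟨I, hI, hsI⟩⟩
  rw [Finset.sum_congr rfl hl, Finset.sum_congr rfl hr, Finset.sum_const, smul_eq_mul,
    ← Finset.card_filter] at h
  rw [← h, mul_comm]

open Classical in
/-- The number of edges disjoint from the support of `B`. -/
theorem two_mul_card_add [Fintype S] (hp : IsCyclicParam G N p) (hN : Odd N)
    {B : Finset (Finset S)} (hB : ∀ I ∈ B, IsOddInterval G I) (h0 : CondP0 G B)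
    (h1 : CondP1 G B) :
    2 * B.card + (G.edgeFinset.filter fun z => ¬ ∃ s ∈ z, s ∈ supp B).card = Fintype.card S := by
  rw [hp.two_mul_card hN hB h0 h1, Finset.card_filter_add_card_filter_not, hp.card_edgeFinset]

end IsCyclicParam

theorem exists_isCyclicParam {S : Type*} {G : SimpleGraph S} {N : ℕ} (hN : 3 ≤ N)
    (f : G ≃g SimpleGraph.cycleGraph N) : ∃ p, IsCyclicParam G N p := by
  obtain ⟨n, rfl⟩ := Nat.exists_eq_add_of_le' hN
  have hdvd : ∀ i : ℤ, ((n + 3 : ℕ) : ℤ) ∣ i ↔ (i : ZMod (n + 3)) = 0 := fun i =>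
    (ZMod.intCast_zmod_eq_zero_iff_dvd i (n + 3)).symm
  -- The vertex type `Fin (n + 3)` is reread as `ZMod (n + 3)`, so that the winding map is the cast
  -- from `ℤ`.
  obtain ⟨g, hg⟩ : ∃ g : ZMod (n + 3) ≃ S, ∀ x y, G.Adj (g x) (g y) ↔ x - y = 1 ∨ y - x = 1 :=
    ⟨f.symm.toEquiv, fun x y => f.symm.map_adj_iff.trans SimpleGraph.cycleGraph_adj⟩
  refine ⟨fun i => g i, hN, fun s => ?_, fun i j => ?_, fun i j => ?_⟩
  · obtain ⟨i, hi⟩ := ZMod.intCast_surjective (n := n + 3) (g.symm s)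
    exact ⟨i, by simp [hi]⟩
  · rw [g.injective.eq_iff, hdvd, Int.cast_sub, sub_eq_zero]
  · have h1 : ∀ x y : ZMod (n + 3), x - y - 1 = 0 ↔ x - y = 1 := fun x y => sub_eq_zero
    have h2 : ∀ x y : ZMod (n + 3), x - y + 1 = 0 ↔ y - x = 1 := fun x y => by
      rw [← sub_eq_zero (a := y - x), ← neg_eq_zero]
      ring_nf
    rw [hg, hdvd, hdvd]
    push_cast
    rw [h1, h2]

/-! ### Linear forms on the quotient attached to edges. -/

section

variable {S V : Type*} [AddCommGroup V] [Module (ZMod 2) V] (e : Module.Basis S (ZMod 2) V)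

theorem repr_vecSum [DecidableEq S] (I : Finset S) (s : S) :
    e.repr (vecSum e I) s = if s ∈ I then 1 else 0 := by
  simp [vecSum, Finsupp.single_apply]

variable [Fintype S]

theorem vecSum_quotVec (I : Finset S) :
    vecSum (quotVec e) I = Submodule.Quotient.mk (vecSum e I) :=
  (map_sum (Submodule.mkQ (Submodule.span (ZMod 2) {vecSum e Finset.univ})) _ _).symm

/-- The sum of the coordinates at `s` and `t`, a linear form on `V / F e_S`. -/
noncomputable def coordAdd (s t : S) : QuotV e →ₗ[ZMod 2] ZMod 2 :=
  Submodule.liftQ _ (e.coord s + e.coord t) <| by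
    classical
    rw [Submodule.span_singleton_le_iff_mem, LinearMap.mem_ker, LinearMap.add_apply,
      Module.Basis.coord_apply, Module.Basis.coord_apply, repr_vecSum, repr_vecSum]
    simp only [Finset.mem_univ, if_true]
    rfl

theorem coordAdd_mk (s t : S) (v : V) :
    coordAdd e s t (Submodule.Quotient.mk v) = e.repr v s + e.repr v t := rfl

open Classical in
theorem coordAdd_vecSum (s t : S) (I : Finset S) :
    coordAdd e s t (vecSum (quotVec e) I) = if Crosses I s(s, t) then 1 else 0 := by
  rw [vecSum_quotVec, coordAdd_mk, repr_vecSum, repr_vecSum, crosses_mk]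
  by_cases hs : s ∈ I <;> by_cases ht : t ∈ I <;> simp [hs, ht]
  rfl

variable {e}

/-- The linear forms attached to the edges of a cycle separate the points of `V / F e_S`. -/
theorem IsCyclicParam.eq_of_coordAdd_eq {G : SimpleGraph S} {N : ℕ} {p : ℤ → S}
    (hp : IsCyclicParam G N p) {x y : QuotV e}
    (h : ∀ s t, G.Adj s t → coordAdd e s t x = coordAdd e s t y) : x = y := by
  classical
  rw [← sub_eq_zero]
  have h' : ∀ s t, G.Adj s t → coordAdd e s t (x - y) = 0 := fun s t hst => by
    rw [map_sub, h s t hst, sub_self]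
  obtain ⟨v, hv⟩ := Submodule.Quotient.mk_surjective _ (x - y)
  rw [← hv] at h' ⊢
  -- Vanishing on all edges makes the coordinates of `v` constant around the cycle, so `v` is a
  -- multiple of `e_S`.
  have hstep : ∀ i, e.repr v (p i) = e.repr v (p (i + 1)) := fun i => by
    have := h' _ _ (hp.adj_succ i)
    rw [coordAdd_mk] at this
    exact CharTwo.add_eq_zero.1 this
  have hconst : ∀ i, e.repr v (p i) = e.repr v (p 0) := by
    intro i
    induction i with
    | zero => rfl
    | succ i ih => rw [← hstep, ih]
    | pred i ih => rw [hstep, sub_add_cancel, ih]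
  rw [Submodule.Quotient.mk_eq_zero, Submodule.mem_span_singleton]
  refine ⟨e.repr v (p 0), e.repr.injective (Finsupp.ext fun s => ?_)⟩
  obtain ⟨i, rfl⟩ := hp.surj s
  rw [map_smul, Finsupp.smul_apply, repr_vecSum, hconst i]
  simp

end

/-! ### The main theorem. -/

theorem mainTheorem4 {S V : Type*} [Fintype S] [DecidableEq S]
    [AddCommGroup V] [Module (ZMod 2) V]
    (ω : LinearMap.BilinForm (ZMod 2) V) (e : Module.Basis S (ZMod 2) V)
    (h : IsAffineCase ω e)
    (B : Finset (Finset S)) (hB : B ∈ phi (quotForm h) (quotVec e)) :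
    B.card ≤ (Fintype.card S - 1) / 2 ∧
    ∀ edge ∈ (edgeGraph (quotForm h) (quotVec e)).edgeSet,
      (edgeVec h edge ∈ spanL (quotVec e) B ↔
        supp B ∩ edge.toFinset = ∅ ∧ B.card = (Fintype.card S - 1) / 2) := by
  classical
  obtain ⟨f⟩ := h.cycle
  -- The induced form has the same values on the classes of the basis vectors, so the graph is
  -- unchanged by passing to the quotient.
  have hG : edgeGraph (quotForm h) (quotVec e) = edgeGraph ω e := rfl
  obtain ⟨hodd, h0, h1⟩ := hB
  rw [← hG] at f
  unfold edgeVec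
  generalize edgeGraph (quotForm h) (quotVec e) = G at *
  obtain ⟨p, hp⟩ := exists_isCyclicParam h.three_le f
  have hN := h.odd_card
  have hcard := hp.two_mul_card_add hN hodd h0 h1
  have huniq := fun z hz hs => hp.existsUnique_crosses hN hodd h0 h1 (z := z) hz hs
  have hmeet : ∀ I ∈ B, ∀ z, Crosses I z → ∃ s ∈ z, s ∈ supp B := by
    rintro I hI z ⟨⟨s, hsz, hs⟩, -⟩
    exact ⟨s, hsz, Finset.mem_biUnion.2 ⟨I, hI, hs⟩⟩
  set M := G.edgeFinset.filter fun z => ¬ ∃ s ∈ z, s ∈ supp B with hM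
  -- Both this and `hle` come from `2 * B.card + M.card = N` with `N` odd.
  have hmax : B.card = (Fintype.card S - 1) / 2 ↔ M.card = 1 := by
    obtain ⟨k, hk⟩ := hN
    lia
  have hle : B.card ≤ (Fintype.card S - 1) / 2 := by
    obtain ⟨k, hk⟩ := hN
    lia
  refine ⟨hle, fun a ha => ?_⟩
  have hval : ∀ c : Finset S → ZMod 2, ∀ s t, coordAdd e s t (∑ I ∈ B, c I • vecSum (quotVec e) I) =
      ∑ I ∈ B, if Crosses I s(s, t) then c I else 0 := by
    intro c s t
    simp [map_sum, coordAdd_vecSum]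
  have hval1 : ∀ c : Finset S → ZMod 2, ∀ z, ∀ I ∈ B, Crosses I z → z ∈ G.edgeSet →
      ∑ J ∈ B, (if Crosses J z then c J else 0) = c I := by
    intro c z I hI hIz hz
    rw [Finset.sum_eq_single_of_mem I hI, if_pos hIz]
    intro J hJ hne
    exact if_neg fun hJz => hne ((huniq z hz (hmeet I hI z hIz)).unique ⟨hJ, hJz⟩ ⟨hI, hIz⟩)
  have hval0 : ∀ c : Finset S → ZMod 2, ∀ z, (¬ ∃ s ∈ z, s ∈ supp B) →
      ∑ J ∈ B, (if Crosses J z then c J else 0) = 0 := fun c z hz =>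
    Finset.sum_eq_zero fun J hJ => if_neg fun hJz => hz (hmeet J hJ z hJz)
  have hdisj : supp B ∩ a.toFinset = ∅ ↔ ¬ ∃ s ∈ a, s ∈ supp B := by
    rw [← Finset.disjoint_iff_inter_eq_empty, Finset.disjoint_right]
    simp
  -- The right-hand side now reads `M = {a}`, a condition that can be tested edge by edge.
  have hone : supp B ∩ a.toFinset = ∅ ∧ B.card = (Fintype.card S - 1) / 2 ↔
      ∀ z ∈ G.edgeSet, (¬ ∃ s ∈ z, s ∈ supp B) ↔ z = a := by
    have hMz : ∀ z, z ∈ M ↔ z ∈ G.edgeSet ∧ ¬ ∃ s ∈ z, s ∈ supp B := fun z => by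
      rw [hM, Finset.mem_filter, SimpleGraph.mem_edgeFinset]
    rw [hdisj, hmax, Finset.card_eq_one]
    constructor
    · rintro ⟨h2, b, hb⟩ z hz
      have haM := (hMz a).2 ⟨ha, h2⟩
      rw [hb, Finset.mem_singleton] at haM
      subst haM
      have := hMz z
      rw [hb, Finset.mem_singleton] at this
      exact ⟨fun hs => this.2 ⟨hz, hs⟩, fun hza => (this.1 hza).2⟩
    · intro h2
      refine ⟨(h2 a ha).2 rfl, a, ?_⟩
      ext z
      rw [hMz, Finset.mem_singleton]
      constructor
      · rintro ⟨hz, h3⟩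
        exact (h2 z hz).1 h3
      · rintro rfl
        exact ⟨ha, (h2 _ ha).2 rfl⟩
  rw [hone, spanL, Submodule.mem_span_image_finset_iff_exists_fun']
  have hedge : ∀ s t, G.Adj s t → coordAdd e s t
      (vecSum (quotVec e) (oddPart G (Finset.univ \ a.toFinset))) =
      if s(s, t) ≠ a then 1 else 0 := by
    intro s t hst
    rw [coordAdd_vecSum]
    exact if_congr (hp.crosses_oddPart_compl hN ha hst) rfl rfl
  constructor
  · rintro ⟨c, hc⟩
    have key : ∀ z ∈ G.edgeSet, ∑ J ∈ B, (if Crosses J z then c J else 0) =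
        if z ≠ a then 1 else 0 := by
      intro z hz
      induction z with | _ s t =>
      rw [← hval, hc, hedge s t hz]
    have hc1 : ∀ I ∈ B, c I = 1 := by
      intro I hI
      have h2 := hp.card_crosses (hodd I hI).1
      -- Of the two edges crossing `I`, at least one differs from `a`, and there the target vector
      -- takes the value 1.
      obtain ⟨z, hz, hza⟩ := Finset.exists_mem_ne (by rw [h2]; exact one_lt_two) a
      rw [Finset.mem_filter, SimpleGraph.mem_edgeFinset] at hz
      have := key z hz.1
      rwa [hval1 c z I hI hz.2 hz.1, if_pos hza] at this
    intro z hz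
    have hkz := key z hz
    constructor
    · intro hs
      by_contra hza
      rw [hval0 c z hs, if_pos hza] at hkz
      exact zero_ne_one hkz
    · rintro rfl hs
      obtain ⟨I, ⟨hI, hIz⟩, -⟩ := huniq z hz hs
      rw [hval1 c z I hI hIz hz, hc1 I hI, if_neg (not_not.2 rfl)] at hkz
      exact one_ne_zero hkz
  · intro h2
    -- The edge vector is the sum of all $\bar e_I$ with $I\in B$.
    refine ⟨fun _ => 1, hp.eq_of_coordAdd_eq fun s t hst => ?_⟩
    rw [hval, hedge s t hst]
    have h3 := h2 s(s, t) hst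
    by_cases hs : ∃ x ∈ s(s, t), x ∈ supp B
    · obtain ⟨I, ⟨hI, hIz⟩, -⟩ := huniq _ hst hs
      rw [hval1 _ _ I hI hIz hst, if_pos fun h4 => h3.2 h4 hs]
    · rw [hval0 _ _ hs, if_neg (not_not.2 (h3.1 hs))]
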